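/- Let $d\ge 1$ and let $a,b,c$ be integers with $d\mid a+b+c$. Suppose that the linear map $\psi(z_1,z_2,z_3)=(\zeta^{a}z_1,\zeta^{b}z_2,\zeta^{c}z_3)$ of $\mathbb C^3$, where $\zeta=e^{2\pi i/d}$, has order exactly $d$ (equivalently, $\gcd(a,b,c,d)=1$), so that the cyclic group $\mu_d$ of order $d$ acts effectively on $\mathbb C^3$ with weights $(a,b,c)$. Let $\mathcal L\subset\mathbb R^3$ be the lattice spanned over $\mathbb Z$ by the standard unit vectors $e^1,e^2,e^3$ and the vector $(a/d,b/d,c/d)$. Let $\sigma=\{x\in\mathbb R^3 : x_1,x_2,x_3\ge 0\}$, and let $\mathcal F=\sigma\cap\{x_1+x_2+x_3=1\}$, which is a triangle. A smooth decomposition of $\mathcal F$ is a finite (geometric) simplicial complex in $\mathbb R^3$ whose underlying space is $\mathcal F$ and such that the three vertices of each of its two-simplices form a $\mathbb Z$-basis of $\mathcal L$. Put \[ d_1=\gcd(a,d),\quad d_2=\gcd(b,d),\quad d_3=\gcd(c,d).\] Then every smooth decomposition of $\mathcal F$ has exactly \[ v=\frac{d+2+(d_1+d_2+d_3)}{2}\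 \text{ vertices and }\ e=\frac{3d+(d_1+d_2+d_3)}{2}\ \text{ edges,}\] where the three corners of $\mathcal F$ are counted among the vertices. Here $d$ is arbitrary (not necessarily odd), and the $d_i$ need not be equal to $1$, i.e. the singular point of $\mathbb C^3/\mu_d$ need not be isolated. -/

import Mathlib

/-- The linear automorphism `ψ (z₁, z₂, z₃) = (ζ^a z₁, ζ^b z₂, ζ^c z₃)` of `ℂ³`, where
`ζ = exp (2πi / d)` and `w = (a, b, c)`. -/
noncomputable def quotientGenerator (d : ℕ) (w : Fin 3 → ℤ) : Module.End ℂ (Fin 3 → ℂ) :=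
  Matrix.toLin' (Matrix.diagonal fun i =>
    Complex.exp (2 * (Real.pi : ℂ) * Complex.I * ((w i : ℂ) / (d : ℂ))))

/-- The lattice in `ℝ³` spanned over `ℤ` by the standard unit vectors and by
`(a/d, b/d, c/d)`, where `w = (a, b, c)`. -/
def quotientLattice (d : ℕ) (w : Fin 3 → ℤ) : Submodule ℤ (Fin 3 → ℝ) :=
  Submodule.span ℤ
    (Set.range (fun i : Fin 3 => (Pi.single i 1 : Fin 3 → ℝ)) ∪
      {fun i : Fin 3 => (w i : ℝ) / (d : ℝ)})

/-- The positive octant of `ℝ³`. -/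
def octant : Set (Fin 3 → ℝ) := {x | ∀ i, 0 ≤ x i}

/-- The triangle cut out of the positive octant by the plane `x₁ + x₂ + x₃ = 1`. -/
def triangleFace : Set (Fin 3 → ℝ) := octant ∩ {x | ∑ i, x i = 1}

/-- A finite simplicial complex `K` is a smooth decomposition of the triangle if it subdivides
the triangle and the vertices of each of its two-simplices form a `ℤ`-basis of the lattice. -/
structure IsSmoothDecomposition (d : ℕ) (w : Fin 3 → ℤ)
    (K : Geometry.SimplicialComplex ℝ (Fin 3 → ℝ)) : Prop where
  finite : K.faces.Finite
  space_eq : K.space = triangleFace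
  isBasis : ∀ s ∈ K.faces, s.card = 3 →
    LinearIndependent ℤ ((↑) : s → (Fin 3 → ℝ)) ∧
      Submodule.span ℤ (s : Set (Fin 3 → ℝ)) = quotientLattice d w

/-!
Let `height x = x₁ + x₂ + x₃`. The cones over the two-simplices of a smooth decomposition cover the
octant, because the cones over the smaller simplices have empty interior. Each of them is generated
by a `ℤ`-basis of the lattice lying at height `1`, so a lattice point of the octant at height
`m > 0` is a sum of `m` vertices of a common face. Hence the vertices are the lattice points at
height `1`, and sending a face with at most two vertices to twice its centroid is a bijection onto
the lattice points at height `2`; it is injective because the centroid of a face determines the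
face.

It remains to count lattice points at height `m`. Modulo `ℤ³` the lattice has the `d` classes of
`k • w / d`, whose representatives in `[0, 1)³` have height `age k`, so the count is the sum of
`(m + 2 - age k).choose 2` over `k < d`. The ages lie in `{0, 1, 2}`, only `k = 0` has age `0`, and
they are summed by pairing `k` with `-k`, since `fract t + fract (-t)` is `1` unless `t` is an
integer.
-/

open Module Geometry

theorem linearIndependent_of_affineIndependent_of_map_eq_one {k V ι : Type*} [Ring k]
    [AddCommGroup V] [Module k V] {p : ι → V} (hp : AffineIndependent k p) (f : V →ₗ[k] k)
    (hf : ∀ i, f (p i) = 1) : LinearIndependent k p := by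
  rw [linearIndependent_iff']
  intro s g hg
  refine affineIndependent_iff.1 hp s g ?_ hg
  simpa [map_sum, hf] using congrArg f hg

theorem mem_hull_range_iff_exists_fun {R E ι : Type*} [Semiring R] [PartialOrder R]
    [IsOrderedRing R] [AddCommMonoid E] [Module R E] [Fintype ι] {v : ι → E} {x : E} :
    x ∈ PointedCone.hull R (Set.range v) ↔ ∃ c : ι → R, 0 ≤ c ∧ ∑ i, c i • v i = x := by
  rw [Submodule.mem_span_range_iff_exists_fun]
  exact ⟨fun ⟨c, hc⟩ => ⟨fun i => c i, fun i => (c i).2, hc⟩,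
    fun ⟨c, hc, hx⟩ => ⟨fun i => ⟨c i, hc i⟩, hx⟩⟩

theorem mem_closure_range_of_mem_span_int_of_mem_hull {R E ι : Type*} [Ring R] [LinearOrder R]
    [IsStrictOrderedRing R] [AddCommGroup E] [Module R E] [Finite ι] {v : ι → E}
    (hv : LinearIndependent R v) {x : E} (hint : x ∈ Submodule.span ℤ (Set.range v))
    (hhull : x ∈ PointedCone.hull R (Set.range v)) : x ∈ AddSubmonoid.closure (Set.range v) := by
  cases nonempty_fintype ι
  obtain ⟨z, hz⟩ := (Submodule.mem_span_range_iff_exists_fun ℤ).1 hint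
  obtain ⟨c, hc, hcx⟩ := mem_hull_range_iff_exists_fun.1 hhull
  have hzc : (fun i => (z i : R)) = c := by
    refine hv.fintypeLinearCombination_injective ?_
    simp only [Fintype.linearCombination_apply, Int.cast_smul_eq_zsmul, hz, hcx]
  have hz0 (i : ι) : 0 ≤ z i := Int.cast_nonneg_iff.1 ((hc i).trans_eq (congrFun hzc i).symm)
  rw [← hz]
  refine sum_mem fun i _ => ?_
  lift z i to ℕ using hz0 i with n
  rw [natCast_zsmul]
  exact nsmul_mem (AddSubmonoid.subset_closure (Set.mem_range_self i)) n

theorem isClosed_hull_range_of_linearIndependent {E ι : Type*} [AddCommGroup E] [Module ℝ E]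
    [TopologicalSpace E] [IsTopologicalAddGroup E] [ContinuousSMul ℝ E] [T2Space E] [Finite ι]
    {v : ι → E} (hv : LinearIndependent ℝ v) :
    IsClosed (PointedCone.hull ℝ (Set.range v) : Set E) := by
  cases nonempty_fintype ι
  have himage : (PointedCone.hull ℝ (Set.range v) : Set E) =
      Fintype.linearCombination ℝ v '' Set.Ici 0 := by
    ext x
    exact mem_hull_range_iff_exists_fun
  rw [himage]
  exact (LinearMap.isClosedEmbedding_of_injective
    (LinearMap.ker_eq_bot.2 hv.fintypeLinearCombination_injective)).isClosedMap _ isClosed_Ici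

theorem interior_iUnion_hull_eq_empty {E : Type*} [NormedAddCommGroup E] [NormedSpace ℝ E]
    [FiniteDimensional ℝ E] {𝒮 : Set (Finset E)} (hfin : 𝒮.Finite)
    (hcard : ∀ s ∈ 𝒮, s.card < finrank ℝ E) :
    interior (⋃ s ∈ 𝒮, (PointedCone.hull ℝ (s : Set E) : Set E)) = ∅ := by
  borelize E
  refine MeasureTheory.Measure.interior_eq_empty_of_null (μ := MeasureTheory.Measure.addHaar) ?_
  rw [MeasureTheory.measure_biUnion_null_iff hfin.countable]
  intro s hs
  refine MeasureTheory.measure_mono_null (PointedCone.hull_le_span ℝ (s : Set E))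
    (MeasureTheory.Measure.addHaar_submodule _ _ fun htop => ?_)
  have := finrank_span_finset_le_card (R := ℝ) s
  rw [Set.finrank, htop, finrank_top] at this
  exact this.not_gt (hcard s hs)

theorem exists_mem_hull_of_card_eq_finrank {E : Type*} [NormedAddCommGroup E] [NormedSpace ℝ E]
    [FiniteDimensional ℝ E] {𝒮 : Set (Finset E)} (hfin : 𝒮.Finite)
    (hind : ∀ s ∈ 𝒮, LinearIndependent ℝ ((↑) : s → E)) {C : Set E}
    (hC : C ⊆ closure (interior C))
    (hcover : C ⊆ ⋃ s ∈ 𝒮, (PointedCone.hull ℝ (s : Set E) : Set E)) {x : E} (hx : x ∈ C) :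
    ∃ s ∈ 𝒮, s.card = finrank ℝ E ∧ x ∈ PointedCone.hull ℝ (s : Set E) := by
  let full := {s ∈ 𝒮 | s.card = finrank ℝ E}
  let thin := {s ∈ 𝒮 | s.card < finrank ℝ E}
  let cones (𝒯 : Set (Finset E)) : Set E := ⋃ s ∈ 𝒯, PointedCone.hull ℝ (s : Set E)
  have hclosed : IsClosed (cones full) := by
    refine (hfin.subset (Set.sep_subset _ _)).isClosed_biUnion fun s hs => ?_
    simpa using isClosed_hull_range_of_linearIndependent (hind s hs.1)
  have hthin : interior (cones thin) = ∅ :=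
    interior_iUnion_hull_eq_empty (hfin.subset (Set.sep_subset _ _)) fun s hs => hs.2
  have hunion : 𝒮 = full ∪ thin := by
    rw [← Set.sep_or]
    refine (Set.sep_eq_self_iff_mem_true.2 fun s hs => ?_).symm
    simpa using (hind s hs).fintype_card_le_finrank.eq_or_lt
  have hinterior : interior C ⊆ cones full := by
    rw [hunion, Set.biUnion_union] at hcover
    calc interior C ⊆ interior (cones full ∪ cones thin) := interior_mono hcover
      _ = interior (cones full) := interior_union_isClosed_of_interior_empty hclosed hthin
      _ ⊆ cones full := interior_subset
  have := closure_minimal hinterior hclosed (hC hx)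
  simpa [cones, full, and_assoc] using this

theorem subset_of_centroid_mem_affineSpan {k V P ι : Type*} [DivisionRing k] [CharZero k]
    [AddCommGroup V] [Module k V] [AddTorsor V P] {p : ι → P} (hp : AffineIndependent k p)
    {s : Finset ι} (hs : s.Nonempty) {t : Set ι}
    (h : s.centroid k p ∈ affineSpan k (p '' t)) : (s : Set ι) ⊆ t := by
  intro i hi
  by_contra hit
  rw [Finset.centroid_def] at h
  have := hp.eq_zero_of_affineCombination_mem_affineSpan
    (s.sum_centroidWeights_eq_one_of_nonempty k hs) h hi hit
  simp [hs.ne_empty] at this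

section SimplicialComplex

variable {k E : Type*} [Field k] [LinearOrder k] [IsStrictOrderedRing k] [AddCommGroup E]
  [Module k E]

theorem subset_of_centroid_mem_convexHull {K : SimplicialComplex k E} {s t : Finset E}
    (hs : s ∈ K.faces) (ht : t ∈ K.faces)
    (h : s.centroid k id ∈ convexHull k (t : Set E)) : s ⊆ t := by
  have hs0 := K.nonempty_of_mem_faces hs
  have hmem := K.inter_subset_convexHull hs ht ⟨s.centroid_mem_convexHull hs0, h⟩
  have hspan : (Finset.univ : Finset s).centroid k (↑) ∈
      affineSpan k (((↑) : s → E) '' ((↑) ⁻¹' (t : Set E))) := by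
    rw [Finset.centroid_univ]
    exact (Subtype.image_preimage_coe (s : Set E) t).symm ▸ convexHull_subset_affineSpan _ hmem
  have hsub := subset_of_centroid_mem_affineSpan (K.indep hs) hs0.attach hspan
  exact fun x hx => hsub (Finset.mem_coe.2 (Finset.mem_univ ⟨x, hx⟩))

theorem injOn_centroid_faces (K : SimplicialComplex k E) :
    Set.InjOn (fun s : Finset E => s.centroid k id) K.faces := by
  intro s hs t ht (hst : s.centroid k id = t.centroid k id)
  have h {s : Finset E} (hs : s ∈ K.faces) : s.centroid k id ∈ convexHull k (s : Set E) :=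
    s.centroid_mem_convexHull (K.nonempty_of_mem_faces hs)
  exact (subset_of_centroid_mem_convexHull hs ht (hst ▸ h ht)).antisymm
    (subset_of_centroid_mem_convexHull ht hs (hst ▸ h hs))

theorem two_smul_centroid_pair [DecidableEq E] (u v : E) :
    (2 : k) • ({u, v} : Finset E).centroid k id = u + v := by
  have := invertibleOfNonzero (two_ne_zero' k)
  rw [Finset.centroid_pair, vadd_eq_add, vsub_eq_sub, smul_add, smul_inv_smul₀ two_ne_zero,
    two_smul]
  simp only [id]
  abel

end SimplicialComplex

theorem exists_eq_pair_of_card_le_two {α : Type*} [DecidableEq α] {s : Finset α} (hs : s.Nonempty)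
    (hcard : s.card ≤ 2) : ∃ u v, s = {u, v} := by
  have := hs.card_pos
  obtain h1 | h2 : s.card = 1 ∨ s.card = 2 := by omega
  · obtain ⟨u, rfl⟩ := Finset.card_eq_one.1 h1
    exact ⟨u, u, (Finset.pair_eq_singleton u).symm⟩
  · obtain ⟨u, v, -, rfl⟩ := Finset.card_eq_two.1 h2
    exact ⟨u, v, rfl⟩

theorem mem_convexHull_range_of_mem_hull_range {k E ι : Type*} [Field k] [LinearOrder k]
    [IsStrictOrderedRing k] [AddCommGroup E] [Module k E] [Finite ι] {v : ι → E} {f : E →ₗ[k] k}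
    (hf : ∀ i, f (v i) = 1) {x : E} (hx : x ∈ PointedCone.hull k (Set.range v)) (hfx : f x = 1) :
    x ∈ convexHull k (Set.range v) := by
  cases nonempty_fintype ι
  obtain ⟨c, hc, rfl⟩ := mem_hull_range_iff_exists_fun.1 hx
  refine (convex_convexHull k _).sum_mem (fun i _ => hc i) (by simpa [hf] using hfx) fun i _ => ?_
  exact subset_convexHull k _ (Set.mem_range_self i)

theorem octant_eq_Ici : octant = Set.Ici 0 := rfl

theorem octant_subset_closure_interior : octant ⊆ closure (interior octant) := by
  rw [octant_eq_Ici, ← Set.pi_univ_Ici, interior_pi_set Set.finite_univ, closure_pi_set]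
  simp

/-- The linear form `x ↦ x₁ + x₂ + x₃`, which equals `1` on `triangleFace`. -/
def height : (Fin 3 → ℝ) →ₗ[ℝ] ℝ := ∑ i, LinearMap.proj i

theorem height_apply (x : Fin 3 → ℝ) : height x = ∑ i, x i := by
  simp [height]

theorem exists_mem_triangleFace_smul_eq {x : Fin 3 → ℝ} (hx : x ∈ octant) :
    ∃ y ∈ triangleFace, height x • y = x := by
  rw [height_apply]
  obtain h0 | h0 := eq_or_ne (∑ i, x i) 0
  · refine ⟨Pi.single 0 1, ⟨fun i => ?_, by simp⟩, ?_⟩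
    · exact (Pi.single_nonneg.2 zero_le_one : (0 : Fin 3 → ℝ) ≤ Pi.single 0 1) i
    · rw [h0, zero_smul]
      ext i
      exact ((Finset.sum_eq_zero_iff_of_nonneg fun i _ => hx i).1 h0 i (Finset.mem_univ i)).symm
  · refine ⟨(∑ i, x i)⁻¹ • x, ⟨fun i => ?_, ?_⟩, smul_inv_smul₀ h0 x⟩
    · exact mul_nonneg (inv_nonneg.2 (Finset.sum_nonneg fun i _ => hx i)) (hx i)
    · simp [← Finset.mul_sum, h0]

/-- The points of the lattice in the octant at height `m`, i.e. those of the `m`-th dilate of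
`triangleFace`. -/
def latticePointsAtHeight (d : ℕ) (w : Fin 3 → ℤ) (m : ℕ) : Set (Fin 3 → ℝ) :=
  {x | x ∈ quotientLattice d w ∧ x ∈ octant ∧ height x = m}

namespace IsSmoothDecomposition

variable {d : ℕ} {w : Fin 3 → ℤ} {K : SimplicialComplex ℝ (Fin 3 → ℝ)} {s : Finset (Fin 3 → ℝ)}
  {x : Fin 3 → ℝ}

theorem mem_triangleFace (hK : IsSmoothDecomposition d w K) (hs : s ∈ K.faces) (hx : x ∈ s) :
    x ∈ triangleFace :=
  hK.space_eq ▸ K.subset_space hs hx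

theorem height_eq_one (hK : IsSmoothDecomposition d w K) (hs : s ∈ K.faces) (hx : x ∈ s) :
    height x = 1 :=
  (height_apply x).trans (hK.mem_triangleFace hs hx).2

theorem linearIndependent (hK : IsSmoothDecomposition d w K) (hs : s ∈ K.faces) :
    LinearIndependent ℝ ((↑) : s → (Fin 3 → ℝ)) :=
  linearIndependent_of_affineIndependent_of_map_eq_one (K.indep hs) height fun y =>
    hK.height_eq_one hs y.2

theorem octant_subset_iUnion_hull (hK : IsSmoothDecomposition d w K) :
    octant ⊆ ⋃ s ∈ K.faces, (PointedCone.hull ℝ (s : Set (Fin 3 → ℝ)) : Set (Fin 3 → ℝ)) := by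
  intro x hx
  obtain ⟨y, hy, hyx⟩ := exists_mem_triangleFace_smul_eq hx
  rw [← hK.space_eq, SimplicialComplex.mem_space_iff] at hy
  obtain ⟨s, hs, hys⟩ := hy
  have hyhull : y ∈ PointedCone.hull ℝ (s : Set (Fin 3 → ℝ)) :=
    convexHull_min Submodule.subset_span (PointedCone.convex _) hys
  have hheight : 0 ≤ height x := height_apply x ▸ Finset.sum_nonneg fun i _ => hx i
  exact Set.mem_biUnion hs (hyx ▸ PointedCone.smul_mem _ hheight hyhull)

theorem exists_mem_hull_of_card_eq_three (hK : IsSmoothDecomposition d w K) (hx : x ∈ octant) :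
    ∃ s ∈ K.faces, s.card = 3 ∧ x ∈ PointedCone.hull ℝ (s : Set (Fin 3 → ℝ)) := by
  simpa using exists_mem_hull_of_card_eq_finrank hK.finite (fun _ => hK.linearIndependent)
    octant_subset_closure_interior hK.octant_subset_iUnion_hull hx

theorem mem_quotientLattice (hK : IsSmoothDecomposition d w K) (hs : s ∈ K.faces) (hx : x ∈ s) :
    x ∈ quotientLattice d w := by
  have hvertex : x ∈ K.vertices := K.down_closed hs (by simpa using hx) (by simp)
  obtain ⟨t, ht, htcard, hxt⟩ :=
    hK.exists_mem_hull_of_card_eq_three (hK.mem_triangleFace hs hx).1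
  rw [← Subtype.range_coe (s := (t : Set (Fin 3 → ℝ)))] at hxt
  have hconv := mem_convexHull_range_of_mem_hull_range
    (fun y => hK.height_eq_one ht y.2) hxt (hK.height_eq_one hs hx)
  rw [Subtype.range_coe, K.vertex_mem_convexHull_iff hvertex ht] at hconv
  exact (hK.isBasis t ht htcard).2 ▸ Submodule.subset_span hconv

theorem exists_multiset_sum_eq (hK : IsSmoothDecomposition d w K) {m : ℕ} (hm : m ≠ 0)
    (hx : x ∈ latticePointsAtHeight d w m) :
    ∃ M : Multiset (Fin 3 → ℝ), M.toFinset ∈ K.faces ∧ M.card = m ∧ M.sum = x := by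
  obtain ⟨hlattice, hoctant, hsum⟩ := hx
  obtain ⟨s, hs, hcard, hhull⟩ := hK.exists_mem_hull_of_card_eq_three hoctant
  rw [← (hK.isBasis s hs hcard).2, ← Subtype.range_coe (s := (s : Set (Fin 3 → ℝ)))] at hlattice
  rw [← Subtype.range_coe (s := (s : Set (Fin 3 → ℝ)))] at hhull
  obtain ⟨M, hMs, rfl⟩ := AddSubmonoid.exists_multiset_of_mem_closure
    (mem_closure_range_of_mem_span_int_of_mem_hull (hK.linearIndependent hs) hlattice hhull)
  rw [Subtype.range_coe] at hMs
  have hMcard : M.card = m := by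
    rw [map_multiset_sum,
      Multiset.map_congr rfl fun y hy => hK.height_eq_one hs (hMs y hy)] at hsum
    simpa using hsum
  refine ⟨M, K.down_closed hs (fun y hy => hMs y (Multiset.mem_toFinset.1 hy)) ?_, hMcard, rfl⟩
  rw [Multiset.toFinset_nonempty, ← Multiset.card_pos, hMcard]
  exact Nat.pos_of_ne_zero hm

theorem sum_mem_latticePointsAtHeight (hK : IsSmoothDecomposition d w K)
    {M : Multiset (Fin 3 → ℝ)} (hs : s ∈ K.faces) (hM : ∀ y ∈ M, y ∈ s) :
    M.sum ∈ latticePointsAtHeight d w M.card := by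
  refine ⟨multiset_sum_mem _ fun y hy => hK.mem_quotientLattice hs (hM y hy), ?_, ?_⟩
  · rw [octant_eq_Ici]
    exact Multiset.sum_nonneg fun y hy => (hK.mem_triangleFace hs (hM y hy)).1
  · rw [map_multiset_sum,
      Multiset.map_congr rfl fun y hy => hK.height_eq_one hs (hM y hy)]
    simp

theorem vertices_eq (hK : IsSmoothDecomposition d w K) :
    K.vertices = latticePointsAtHeight d w 1 := by
  ext x
  constructor
  · intro hx
    simpa using hK.sum_mem_latticePointsAtHeight (M := {x}) hx (by simp)
  · intro hx
    obtain ⟨M, hM, hcard, rfl⟩ := hK.exists_multiset_sum_eq one_ne_zero hx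
    obtain ⟨y, rfl⟩ := Multiset.card_eq_one.1 hcard
    exact K.mem_vertices.2 (by simpa using hM)

theorem bijOn_two_smul_centroid (hK : IsSmoothDecomposition d w K) :
    Set.BijOn (fun s => (2 : ℝ) • s.centroid ℝ id) {s ∈ K.faces | s.card ≤ 2}
      (latticePointsAtHeight d w 2) := by
  refine ⟨?_, ?_, ?_⟩
  · rintro s ⟨hs, hcard⟩
    obtain ⟨u, v, rfl⟩ := exists_eq_pair_of_card_le_two (K.nonempty_of_mem_faces hs) hcard
    simp only [two_smul_centroid_pair]
    simpa using hK.sum_mem_latticePointsAtHeight (M := {u, v}) hs (by simp)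
  · exact ((smul_right_injective _ two_ne_zero).comp_injOn (injOn_centroid_faces K)).mono
      (Set.sep_subset _ _)
  · intro x hx
    obtain ⟨M, hM, hcard, rfl⟩ := hK.exists_multiset_sum_eq two_ne_zero hx
    obtain ⟨u, v, rfl⟩ := Multiset.card_eq_two.1 hcard
    have hM : {u, v} ∈ K.faces := by simpa using hM
    refine ⟨{u, v}, ⟨hM, Finset.card_le_two⟩, ?_⟩
    simp only [two_smul_centroid_pair, Multiset.insert_eq_cons, Multiset.sum_cons,
      Multiset.sum_singleton]

theorem ncard_edges_add_ncard_vertices (hK : IsSmoothDecomposition d w K) :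
    {s ∈ K.faces | s.card = 2}.ncard + K.vertices.ncard =
      (latticePointsAtHeight d w 2).ncard := by
  have hunion : {s ∈ K.faces | s.card ≤ 2} =
      {s ∈ K.faces | s.card = 2} ∪ singleton '' K.vertices := by
    ext s
    constructor
    · rintro ⟨hs, hcard⟩
      have := (K.nonempty_of_mem_faces hs).card_pos
      obtain h1 | h2 : s.card = 1 ∨ s.card = 2 := by omega
      · obtain ⟨v, rfl⟩ := Finset.card_eq_one.1 h1
        exact Or.inr ⟨v, hs, rfl⟩
      · exact Or.inl ⟨hs, h2⟩
    · rintro (⟨hs, hcard⟩ | ⟨v, hv, rfl⟩)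
      · exact ⟨hs, hcard.le⟩
      · exact ⟨hv, by simp⟩
  have hdisj : Disjoint {s ∈ K.faces | s.card = 2} (singleton '' K.vertices) := by
    rw [Set.disjoint_left]
    rintro _ ⟨-, hcard⟩ ⟨v, -, rfl⟩
    simp at hcard
  have hfin : ({s ∈ K.faces | s.card = 2} ∪ singleton '' K.vertices).Finite :=
    hunion ▸ hK.finite.subset (Set.sep_subset _ _)
  rw [← hK.bijOn_two_smul_centroid.image_eq, hK.bijOn_two_smul_centroid.injOn.ncard_image, hunion,
    Set.ncard_union_eq hdisj (hfin.subset Set.subset_union_left)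
      (hfin.subset Set.subset_union_right),
    Set.ncard_image_of_injective _ Finset.singleton_injective]

end IsSmoothDecomposition

theorem card_filter_dvd_succ_mul {d : ℕ} (hd : 0 < d) (a : ℤ) :
    ((Finset.range d).filter fun k => (d : ℤ) ∣ (k + 1 : ℕ) * a).card = Int.gcd a d := by
  have hdvd (k : ℕ) : (d : ℤ) ∣ k * a ↔ d / d.gcd a.natAbs ∣ k := by
    rw [Int.natCast_dvd, Int.natAbs_mul, Int.natAbs_natCast,
      Nat.div_dvd_iff_dvd_mul (Nat.gcd_dvd_left _ _) (Nat.gcd_pos_of_pos_left _ hd), mul_comm _ k]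
    exact dvd_mul_gcd_iff_dvd_mul.symm
  simp only [hdvd]
  rw [Nat.card_multiples, Nat.div_div_self (Nat.gcd_dvd_left _ _) hd.ne', Int.gcd_comm]
  rfl

theorem fract_add_fract_neg {k : Type*} [Ring k] [LinearOrder k] [IsStrictOrderedRing k]
    [FloorRing k] (x : k) :
    Int.fract x + Int.fract (-x) = if Int.fract x = 0 then 0 else 1 := by
  split_ifs with h
  · rw [h, Int.fract_neg_eq_zero.2 h, add_zero]
  · rw [Int.fract_neg h, add_sub_cancel]

theorem fract_mul_div_eq_zero_iff {k : Type*} [Field k] [LinearOrder k] [IsStrictOrderedRing k]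
    [FloorRing k] {d : ℕ} (hd : 0 < d) (n : ℕ) (a : ℤ) :
    Int.fract (n * (a / d) : k) = 0 ↔ (d : ℤ) ∣ n * a := by
  have hcast : (n * (a / d) : k) = ((n * a : ℤ) : k) / d := by push_cast; ring
  rw [hcast, Int.fract_div_intCast_eq_div_intCast_mod, div_eq_zero_iff, Int.cast_eq_zero,
    Int.dvd_iff_emod_eq_zero, or_iff_left (by exact_mod_cast hd.ne')]

theorem two_mul_sum_fract {k : Type*} [Field k] [LinearOrder k] [IsStrictOrderedRing k]
    [FloorRing k] {d : ℕ} (hd : 0 < d) (a : ℤ) :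
    2 * ∑ n ∈ Finset.range d, Int.fract (n * (a / d) : k) = d - Int.gcd a d := by
  have hd0 : (d : k) ≠ 0 := by exact_mod_cast hd.ne'
  let f (n : ℕ) : k := Int.fract (n * (a / d) : k)
  have hf0 : f 0 = 0 := by simp [f]
  have hfd : f d = 0 := (fract_mul_div_eq_zero_iff hd d a).2 (dvd_mul_right _ _)
  have hshift : ∑ n ∈ Finset.range d, f n = ∑ n ∈ Finset.range d, f (n + 1) := by
    have h := Finset.sum_range_succ f d
    rwa [Finset.sum_range_succ', hf0, hfd, add_zero, add_zero, eq_comm] at h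
  have hneg (n : ℕ) (hn : n < d) : f (d - 1 - n) = Int.fract (-((n + 1 : ℕ) * (a / d)) : k) := by
    have h : ((d - 1 - n : ℕ) * (a / d) : k) = -((n + 1 : ℕ) * (a / d)) + a := by
      rw [Nat.sub_sub, add_comm 1 n, Nat.cast_sub hn]
      field_simp
      ring
    simp only [f, h, Int.fract_add_intCast]
  calc 2 * ∑ n ∈ Finset.range d, f n
      = ∑ n ∈ Finset.range d, (f (n + 1) + f (d - 1 - n)) := by
        rw [Finset.sum_add_distrib, ← hshift, Finset.sum_range_reflect, two_mul]
    _ = ∑ n ∈ Finset.range d, (1 - if (d : ℤ) ∣ (n + 1 : ℕ) * a then 1 else 0) := by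
        refine Finset.sum_congr rfl fun n hn => ?_
        rw [hneg n (Finset.mem_range.1 hn), fract_add_fract_neg]
        simp only [fract_mul_div_eq_zero_iff hd]
        split_ifs <;> simp
    _ = d - Int.gcd a d := by
        rw [Finset.sum_sub_distrib, Finset.sum_boole, card_filter_dvd_succ_mul hd]
        simp

section BoxPoint

variable {ι : Type*}

/-- The representative in `[0, 1)^ι` of the class of `k • (w / d)` modulo `ℤ^ι`. The cosets of
`ℤ³` in `quotientLattice d w` are those of the box points with `k < d`. -/
noncomputable def boxPoint (d : ℕ) (w : ι → ℤ) (k : ℕ) : ι → ℝ :=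
  fun i => Int.fract (k * (w i / d) : ℝ)

/-- The age of the `k`-th power of the diagonal automorphism with weights `w / d`: the sum of the
coordinates of its box point. It is rounded down to a natural number, which changes nothing when
`d` divides the sum of the weights. -/
noncomputable def age [Fintype ι] (d : ℕ) (w : ι → ℤ) (k : ℕ) : ℕ :=
  ⌊∑ i, boxPoint d w k i⌋₊

variable {d : ℕ} {w : ι → ℤ} {k : ℕ}

theorem boxPoint_nonneg (i : ι) : 0 ≤ boxPoint d w k i :=
  Int.fract_nonneg _

theorem boxPoint_zero : boxPoint d w 0 = 0 := by
  ext i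
  simp [boxPoint]

theorem fract_boxPoint (i : ι) : Int.fract (boxPoint d w k i) = boxPoint d w k i :=
  Int.fract_fract _

variable [Fintype ι]

theorem sum_boxPoint_eq_age (hw : (d : ℤ) ∣ ∑ i, w i) : ∑ i, boxPoint d w k i = age d w k := by
  obtain ⟨c, hc⟩ := hw
  have hcR : ∑ i, (w i : ℝ) = d * c := by exact_mod_cast hc
  have hint : ∃ z : ℤ, ∑ i, boxPoint d w k i = z := by
    refine ⟨(k * if d = 0 then 0 else c) - ∑ i, ⌊(k * (w i / d) : ℝ)⌋, ?_⟩
    simp only [boxPoint, Int.fract, Finset.sum_sub_distrib, ← Finset.mul_sum, ← Finset.sum_div, hcR]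
    split_ifs with h <;> simp [h]
  obtain ⟨z, hz⟩ := hint
  rw [age, natCast_floor_eq_intCast_floor (Finset.sum_nonneg fun i _ => boxPoint_nonneg i), hz,
    Int.floor_intCast]

theorem age_lt_card [Nonempty ι] : age d w k < Fintype.card ι := by
  rw [age, Nat.floor_lt (Finset.sum_nonneg fun i _ => boxPoint_nonneg i)]
  calc ∑ i, boxPoint d w k i < ∑ _i : ι, (1 : ℝ) :=
        Finset.sum_lt_sum_of_nonempty Finset.univ_nonempty fun i _ => Int.fract_lt_one _
    _ = Fintype.card ι := by simp

theorem age_eq_zero_iff (hw : (d : ℤ) ∣ ∑ i, w i) : age d w k = 0 ↔ boxPoint d w k = 0 := by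
  rw [← Nat.cast_eq_zero (R := ℝ), ← sum_boxPoint_eq_age hw,
    Finset.sum_eq_zero_iff_of_nonneg fun i _ => boxPoint_nonneg i, funext_iff]
  simp

theorem two_mul_sum_age (hd : 0 < d) (hw : (d : ℤ) ∣ ∑ i, w i) :
    2 * ∑ k ∈ Finset.range d, (age d w k : ℝ) =
      d * Fintype.card ι - ∑ i, (Int.gcd (w i) d : ℝ) := by
  simp only [← sum_boxPoint_eq_age hw, boxPoint]
  rw [Finset.sum_comm, Finset.mul_sum]
  simp only [two_mul_sum_fract hd, Finset.sum_sub_distrib, Finset.sum_const, Finset.card_univ,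
    nsmul_eq_mul]
  ring

theorem encard_setOf_fract_eq {r : ι → ℝ} (hr : ∀ i, Int.fract (r i) = r i) {s : ℕ}
    (hs : ∑ i, r i = s) (m : ℕ) :
    {x : ι → ℝ | (∀ i, 0 ≤ x i) ∧ ∑ i, x i = m ∧ ∀ i, Int.fract (x i) = r i}.encard =
      {n : ι → ℕ | ∑ i, n i + s = m}.encard := by
  have hinj : Function.Injective fun (n : ι → ℕ) i => (n i + r i : ℝ) := fun n n' h => by
    ext i
    simpa using congrFun h i
  rw [← hinj.encard_image]
  congr 1
  ext x
  constructor
  · rintro ⟨hx, hsum, hfract⟩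
    have hfloor : (fun i => (⌊x i⌋₊ + r i : ℝ)) = x := by
      ext i
      rw [← hfract i, natCast_floor_eq_intCast_floor (hx i), Int.floor_add_fract]
    refine ⟨fun i => ⌊x i⌋₊, ?_, hfloor⟩
    rw [← hfloor, Finset.sum_add_distrib, hs] at hsum
    exact_mod_cast hsum
  · rintro ⟨n, hn, rfl⟩
    refine ⟨fun i => add_nonneg (Nat.cast_nonneg _) (hr i ▸ Int.fract_nonneg _), ?_, fun i => ?_⟩
    · rw [Finset.sum_add_distrib, hs]
      exact_mod_cast hn
    · rw [Int.fract_natCast_add, hr]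

end BoxPoint

theorem encard_setOf_sum_add_eq {ι : Type*} [Fintype ι] {r s m : ℕ}
    (hι : Fintype.card ι = r + 1) (hs : s ≤ m + r) :
    {n : ι → ℕ | ∑ i, n i + s = m}.encard = (m + r - s).choose r := by
  classical
  obtain hlt | hle := lt_or_ge m s
  · rw [Nat.choose_eq_zero_of_lt (by omega), Nat.cast_zero, Set.encard_eq_zero]
    exact Set.eq_empty_of_forall_notMem fun n hn => by grind
  · have hset : {n : ι → ℕ | ∑ i, n i + s = m} =
        (Finset.piAntidiag Finset.univ (m - s) : Finset (ι → ℕ)) := by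
      ext n
      simp [eq_tsub_iff_add_eq_of_le hle]
    rw [hset, Set.encard_coe_eq_coe_finsetCard, ← Finset.map_sym_eq_piAntidiag, Finset.card_map,
      Finset.sym_univ, Finset.card_univ, Sym.card_sym_eq_choose, hι,
      show r + 1 + (m - s) - 1 = m + r - s by omega,
      Nat.choose_symm_of_eq_add (show m + r - s = m - s + r by omega)]

theorem quotientGenerator_pow (d : ℕ) (w : Fin 3 → ℤ) (k : ℕ) :
    quotientGenerator d w ^ k = Matrix.toLin' (Matrix.diagonal fun i =>
      Complex.exp (2 * Real.pi * Complex.I * (boxPoint d w k i : ℂ))) := by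
  rw [quotientGenerator, ← Matrix.toLin'_pow, Matrix.diagonal_pow]
  congr 2
  ext i
  rw [Pi.pow_apply, ← Complex.exp_nat_mul, Complex.exp_eq_exp_iff_exists_int]
  refine ⟨⌊(k * (w i / d) : ℝ)⌋, ?_⟩
  rw [boxPoint, Int.fract]
  push_cast
  ring

theorem injOn_boxPoint_of_orderOf_eq {d : ℕ} {w : Fin 3 → ℤ}
    (horder : orderOf (quotientGenerator d w) = d) : Set.InjOn (boxPoint d w) (Set.Iio d) := by
  intro k hk l hl h
  rw [← horder] at hk hl
  refine pow_injOn_Iio_orderOf hk hl ?_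
  simp only [quotientGenerator_pow, h]

theorem mem_quotientLattice_iff {d : ℕ} {w : Fin 3 → ℤ} (hd : 0 < d) {x : Fin 3 → ℝ} :
    x ∈ quotientLattice d w ↔ ∃ k < d, ∀ i, Int.fract (x i) = boxPoint d w k i := by
  have hd0 : (d : ℝ) ≠ 0 := by exact_mod_cast hd.ne'
  rw [quotientLattice, Submodule.span_union, Submodule.mem_sup]
  simp only [Submodule.mem_span_range_iff_exists_fun, Submodule.mem_span_singleton]
  constructor
  · rintro ⟨_, ⟨z, rfl⟩, _, ⟨k, rfl⟩, rfl⟩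
    obtain ⟨n, hn⟩ := Int.eq_ofNat_of_zero_le (Int.emod_nonneg k (Int.natCast_pos.2 hd).ne')
    have hnd : n < d := by exact_mod_cast hn ▸ Int.emod_lt_of_pos k (Int.natCast_pos.2 hd)
    have hk : (k : ℝ) = n + d * (k / d : ℤ) := by
      exact_mod_cast hn ▸ (Int.emod_add_mul_ediv k d).symm
    refine ⟨n, hnd, fun i => Int.fract_eq_fract.2 ⟨z i + k / d * w i, ?_⟩⟩
    simp only [zsmul_eq_mul, Pi.add_apply, Finset.sum_apply, Pi.mul_apply, Pi.intCast_apply,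
      Pi.single_apply, mul_ite, mul_one, mul_zero, Finset.sum_ite_eq, Finset.mem_univ, ↓reduceIte,
      hk, Int.cast_add, Int.cast_mul]
    field_simp
    ring
  · rintro ⟨k, -, h⟩
    choose z hz using fun i => Int.fract_eq_fract.1 (h i)
    refine ⟨_, ⟨z, rfl⟩, _, ⟨k, rfl⟩, ?_⟩
    ext i
    simp [Finset.sum_apply, Pi.single_apply, ← hz]

theorem encard_latticePointsAtHeight {d : ℕ} {w : Fin 3 → ℤ} (hd : 0 < d)
    (hw : (d : ℤ) ∣ ∑ i, w i) (hinj : Set.InjOn (boxPoint d w) (Set.Iio d)) (m : ℕ) :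
    (latticePointsAtHeight d w m).encard =
      (∑ k ∈ Finset.range d, (m + 2 - age d w k).choose 2 : ℕ) := by
  let coset (k : ℕ) : Set (Fin 3 → ℝ) :=
    {x | (∀ i, 0 ≤ x i) ∧ ∑ i, x i = m ∧ ∀ i, Int.fract (x i) = boxPoint d w k i}
  have hunion : latticePointsAtHeight d w m = ⋃ k : Fin d, coset k := by
    ext x
    simp only [latticePointsAtHeight, mem_quotientLattice_iff hd, height_apply, octant, coset,
      Set.mem_ofPred_eq, Set.mem_iUnion, Fin.exists_iff]
    tauto
  have hdisj : Pairwise (Function.onFun Disjoint fun k : Fin d => coset k) := by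
    refine fun k l hkl => Set.disjoint_left.2 fun x hx hx' => hkl (Fin.ext ?_)
    exact hinj k.2 l.2 (funext fun i => (hx.2.2 i).symm.trans (hx'.2.2 i))
  have hage (k : ℕ) : age d w k ≤ m + 2 := by
    have : age d w k < 3 := age_lt_card
    omega
  rw [hunion, Set.encard_iUnion_of_finite hdisj, finsum_eq_sum_of_fintype, Finset.sum_range,
    Nat.cast_sum]
  refine Finset.sum_congr rfl fun k _ => ?_
  rw [encard_setOf_fract_eq fract_boxPoint (sum_boxPoint_eq_age hw),
    encard_setOf_sum_add_eq (Fintype.card_fin 3) (hage k)]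

theorem two_mul_choose_two_add_sub {s : ℕ} (hs : s < 3) (m : ℕ) :
    2 * ((m + 2 - s).choose 2 : ℝ) = m ^ 2 + (3 - 2 * s) * m + if s = 0 then 2 else 0 := by
  rw [Nat.cast_choose_two]
  interval_cases s <;> push_cast <;> ring

theorem two_mul_ncard_latticePointsAtHeight {d : ℕ} {w : Fin 3 → ℤ} (hd : 0 < d)
    (hw : (d : ℤ) ∣ ∑ i, w i) (hinj : Set.InjOn (boxPoint d w) (Set.Iio d)) (m : ℕ) :
    (2 * (latticePointsAtHeight d w m).ncard : ℝ) =
      d * m ^ 2 + (∑ i, (Int.gcd (w i) d : ℝ)) * m + 2 := by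
  have hage_zero {k : ℕ} (hk : k < d) : age d w k = 0 ↔ k = 0 := by
    rw [age_eq_zero_iff hw, ← boxPoint_zero, hinj.eq_iff hk hd]
  have hterm (k : ℕ) (hk : k ∈ Finset.range d) : 2 * ((m + 2 - age d w k).choose 2 : ℝ) =
      m ^ 2 + 3 * m - m * (2 * age d w k) + if k = 0 then 2 else 0 := by
    have hage : age d w k < 3 := age_lt_card
    simp only [two_mul_choose_two_add_sub hage, hage_zero (Finset.mem_range.1 hk)]
    ring
  rw [Set.ncard, encard_latticePointsAtHeight hd hw hinj, ENat.toNat_natCast, Nat.cast_sum,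
    Finset.mul_sum, Finset.sum_congr rfl hterm, Finset.sum_add_distrib, Finset.sum_sub_distrib,
    ← Finset.mul_sum, ← Finset.mul_sum, two_mul_sum_age hd hw]
  simp only [Finset.sum_const, Finset.card_range, smul_add, nsmul_eq_mul, Fintype.card_fin,
    Nat.cast_ofNat, Finset.sum_ite_eq', Finset.mem_range, hd, ↓reduceIte, add_left_inj]
  ring

theorem lemma1 (d : ℕ) (hd : 0 < d) (a b c : ℤ)
    (horder : orderOf (quotientGenerator d ![a, b, c]) = d)
    (hsum : (d : ℤ) ∣ a + b + c)
    (d₁ d₂ d₃ : ℕ) (hd₁ : d₁ = Int.gcd a d) (hd₂ : d₂ = Int.gcd b d) (hd₃ : d₃ = Int.gcd c d)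
    (K : Geometry.SimplicialComplex ℝ (Fin 3 → ℝ))
    (hK : IsSmoothDecomposition d ![a, b, c] K) :
    (K.vertices.ncard : ℚ) = ((d : ℚ) + 2 + (d₁ + d₂ + d₃)) / 2 ∧
      ({s ∈ K.faces | s.card = 2}.ncard : ℚ) = (3 * (d : ℚ) + (d₁ + d₂ + d₃)) / 2 := by
  have hw : (d : ℤ) ∣ ∑ i, ![a, b, c] i := by simpa [Fin.sum_univ_three] using hsum
  have hgcd : ∑ i, (Int.gcd (![a, b, c] i) d : ℝ) = (d₁ + d₂ + d₃ : ℕ) := by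
    simp [Fin.sum_univ_three, hd₁, hd₂, hd₃]
  have hcount (m : ℕ) : (2 * (latticePointsAtHeight d ![a, b, c] m).ncard : ℚ) =
      d * m ^ 2 + (d₁ + d₂ + d₃) * m + 2 := by
    have h := two_mul_ncard_latticePointsAtHeight hd hw (injOn_boxPoint_of_orderOf_eq horder) m
    rw [hgcd] at h
    exact_mod_cast h
  have hone := hcount 1
  have htwo := hcount 2
  rw [← hK.vertices_eq] at hone
  rw [← hK.ncard_edges_add_ncard_vertices] at htwo
  push_cast at hone htwo
  constructor <;> linarith
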